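/- Let $\mathfrak g$ be a finite-dimensional reductive real Lie algebra (that is, its radical equals its center) with $\dim\mathfrak g\ge 4$. Suppose $\mathfrak g$ carries a locally conformally symplectic (lcs) structure with non-zero Lee form: a non-degenerate $2$-form $\Omega\in\Lambda^2\mathfrak g^*$ (so $\dim\mathfrak g=2n$ and $\Omega^n\neq 0$) and a $1$-form $\vartheta\in\mathfrak g^*$, $\vartheta\ne 0$, such that $d\vartheta=0$ and $d\Omega=\vartheta\wedge\Omega$, where $d$ is the Chevalley--Eilenberg differential of $\mathfrak g$ with trivial coefficients, so that $d\vartheta(X,Y)=-\vartheta([X,Y])$ and $d\Omega(X,Y,Z)=-\Omega([X,Y],Z)-\Omega([Y,Z],X)-\Omega([Z,X],Y)$, and $(\vartheta\wedge\Omega)(X,Y,Z)=\vartheta(X)\Omega(Y,Z)+\vartheta(Y)\Omega(Z,X)+\vartheta(Z)\Omega(X,Y)$. Then $\mathfrak g$ is isomorphic, as a real Lie algebra, to $\mathfrak{su}_2\oplus\mathbb R$ or to $\mathfrak{sl}_2(\mathbb R)\oplus\mathbb R$, where $\mathfrak{su}_2$ is the real Lie algebra of traceless skew-Hermitian complex $2\times2$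 matrices, $\mathfrak{sl}_2(\mathbb R)$ is the Lie algebra of traceless real $2\times 2$ matrices, and $\mathbb R$ is the one-dimensional abelian Lie algebra. In particular, $\dim\mathfrak g=4$. -/

import Mathlib

attribute [local instance 100] LieRing.ofAssociativeRing

namespace LcsLie

/-- The Lie algebra `su_2` of traceless skew-Hermitian complex `2 × 2` matrices, as a real Lie
algebra with the commutator bracket. -/
def su2 : LieSubalgebra ℝ (Matrix (Fin 2) (Fin 2) ℂ) where
  carrier := {A | A.conjTranspose = -A ∧ A.trace = 0}
  add_mem' := by
    rintro A B ⟨hA, hA'⟩ ⟨hB, hB'⟩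
    exact ⟨by rw [Matrix.conjTranspose_add, hA, hB, neg_add], by simp [hA', hB']⟩
  zero_mem' := by simp
  smul_mem' := by
    rintro c A ⟨hA, hA'⟩
    exact ⟨by rw [Matrix.conjTranspose_smul, hA]; simp, by simp [hA']⟩
  lie_mem' := by
    rintro A B ⟨hA, hA'⟩ ⟨hB, hB'⟩
    refine ⟨?_, by simp⟩
    rw [Ring.lie_def, Matrix.conjTranspose_sub, Matrix.conjTranspose_mul,
      Matrix.conjTranspose_mul, hA, hB]
    simp

variable {𝔤 : Type*} [LieRing 𝔤] [LieAlgebra ℝ 𝔤]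

/-- Chevalley–Eilenberg differential (trivial coefficients) of a 1-form:
`dϑ(X,Y) = -ϑ([X,Y])`. -/
def d₁ (ϑ : Module.Dual ℝ 𝔤) (X Y : 𝔤) : ℝ := -ϑ ⁅X, Y⁆

/-- Chevalley–Eilenberg differential (trivial coefficients) of a 2-form:
`dΩ(X,Y,Z) = -Ω([X,Y],Z) - Ω([Y,Z],X) - Ω([Z,X],Y)`. -/
def d₂ (Ω : LinearMap.BilinForm ℝ 𝔤) (X Y Z : 𝔤) : ℝ :=
  -Ω ⁅X, Y⁆ Z - Ω ⁅Y, Z⁆ X - Ω ⁅Z, X⁆ Y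

/-- The wedge product of a 1-form and a 2-form. -/
def wedge₁₂ (ϑ : Module.Dual ℝ 𝔤) (Ω : LinearMap.BilinForm ℝ 𝔤) (X Y Z : 𝔤) : ℝ :=
  ϑ X * Ω Y Z + ϑ Y * Ω Z X + ϑ Z * Ω X Y

/-- `(Ω, ϑ)` is a locally conformally symplectic structure on the real Lie algebra `𝔤` of
dimension at least four: `Ω` is a non-degenerate 2-form (so `dim 𝔤 = 2n` and `Ωⁿ ≠ 0`), `ϑ` is a
closed 1-form, and `dΩ = ϑ ∧ Ω`. -/
structure IsLcs (Ω : LinearMap.BilinForm ℝ 𝔤) (ϑ : Module.Dual ℝ 𝔤) : Prop where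
  four_le_finrank : 4 ≤ Module.finrank ℝ 𝔤
  isAlt : Ω.IsAlt
  nondegenerate : Ω.Nondegenerate
  d_lee : ∀ X Y, d₁ ϑ X Y = 0
  d_form : ∀ X Y Z, d₂ Ω X Y Z = wedge₁₂ ϑ Ω X Y Z

end LcsLie

/-! Let `q` be the quotient of `𝔤` by its center; it is semisimple, with Killing form `κ`. A closed
1-form on `q` vanishes, so `ϑ Z = 1` for some central `Z`, and evaluating `dΩ = ϑ ∧ Ω` at `(X, Y,
Z)` expresses `Ω` through `ϑ` and `Ω Z` (`IsLcs.apply_eq_of_mem_center`). The form `Ω Z ⁅X, Y⁆`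
descends to a 2-cocycle on `q`, hence equals `κ ⁅d, x⁆ y` for some `d`. Since `Ω` is non-degenerate,
the pair `(ϑ, Ω Z)` is injective on the center plus a lift of the centralizer of `d`, so these two
have total dimension at most 2. As `dim 𝔤 ≥ 4`, each is a line.

A centralizer that is a line forces rank at most one: a generic point on the line from `d` to a
regular element is regular and has centralizer of dimension at most one. Root spaces over the
algebraic closure then give `dim q ≤ 3` (`finrank_le_three_of_finrank_ker_ad_eq_one`). So `dim q =
3`, a Killing-orthogonal basis identifies `q` with `su2` or `sl₂(ℝ)`, and `ϑ` splits off the center.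
-/

open Module

/-! ### Linear algebra: ranks along lines of endomorphisms and under base change. -/

namespace LinearMap

variable {K V : Type*} [Field K] [AddCommGroup V] [Module K V] [FiniteDimensional K V]

/-- An injective endomorphism stays injective along a line for all but finitely many parameters. -/
lemma finite_not_injective_add_smul {f : End K V} (hf : Function.Injective f) (g : End K V) :
    {t : K | ¬ Function.Injective (f + t • g)}.Finite := by
  let e : V ≃ₗ[K] V := LinearEquiv.ofInjectiveEndo f hf
  -- For `t ≠ 0`, `f + t • g` is singular exactly when `-t⁻¹` is an eigenvalue of `f⁻¹ ∘ g`.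
  have hfin : {μ : K | End.HasEigenvalue ((e.symm : V →ₗ[K] V) ∘ₗ g) μ}.Finite :=
    End.finite_hasEigenvalue _
  refine (hfin.image fun μ ↦ -μ⁻¹).subset fun t ht ↦ ?_
  have ht' : ker (f + t • g) ≠ ⊥ := fun h ↦ ht (ker_eq_bot.mp h)
  obtain ⟨v, hv, hv0⟩ := Submodule.exists_mem_ne_zero_of_ne_bot ht'
  have hfv : f v = -(t • g v) := by
    simpa [add_eq_zero_iff_eq_neg] using hv
  have hef (w : V) : e.symm (f w) = w := e.symm_apply_apply w
  have ht0 : t ≠ 0 := by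
    rintro rfl
    exact hv0 (hf (by simpa using hfv))
  refine ⟨-t⁻¹, ?_, by simp⟩
  refine End.hasEigenvalue_of_hasEigenvector (x := v) ⟨End.mem_eigenspace_iff.mpr ?_, hv0⟩
  have : v = -(t • e.symm (g v)) := by
    rw [← map_smul, ← map_neg, ← hfv, hef]
  simp only [coe_comp, LinearEquiv.coe_coe, Function.comp_apply]
  conv_rhs => rw [this]
  simp [smul_smul, ht0]

/-- Having a kernel of dimension at most one is an open condition along lines. -/
lemma finite_one_lt_finrank_ker_add_smul {f : End K V} (hf : finrank K (ker f) = 1)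
    (g : End K V) : {t : K | 1 < finrank K (ker (f + t • g))}.Finite := by
  obtain ⟨k, hk0, hk⟩ := finrank_eq_one_iff'.mp hf
  obtain ⟨φ, hφ⟩ := Projective.exists_dual_ne_zero K
    (show (k : V) ≠ 0 from fun h ↦ hk0 (Subtype.ext h))
  have hr : range f ≠ ⊤ := fun h ↦ by
    have := f.finrank_range_add_finrank_ker
    rw [h, finrank_top, hf] at this
    omega
  obtain ⟨w, hw⟩ : ∃ w, w ∉ range f := by
    by_contra! h
    exact hr (eq_top_iff.mpr fun v _ ↦ h v)
  -- A rank-one correction, non-zero on the kernel and with values outside the range, makes `f`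
  -- injective.
  have hinj : Function.Injective (f + φ.smulRight w) := by
    rw [← ker_eq_bot, ker_eq_bot']
    intro v hv
    replace hv : f v + φ v • w = 0 := by simpa using hv
    have hφv : φ v = 0 := by
      by_contra h
      refine hw ⟨-(φ v)⁻¹ • v, ?_⟩
      rw [map_smul, eq_neg_of_add_eq_zero_left hv, neg_smul_neg, smul_smul, inv_mul_cancel₀ h,
        one_smul]
    rw [hφv, zero_smul, add_zero] at hv
    obtain ⟨c, hc⟩ := hk ⟨v, hv⟩
    have hc' : v = c • (k : V) := by simpa using (congrArg Subtype.val hc).symm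
    rw [hc', map_smul, smul_eq_mul] at hφv
    rw [hc', (mul_eq_zero.mp hφv).resolve_right hφ, zero_smul]
  refine (finite_not_injective_add_smul hinj g).subset fun t ht hinj' ↦ ?_
  refine (not_le.mpr (show 1 < finrank K (ker (f + t • g)) from ht)) ?_
  -- Where the corrected map is injective, `φ` embeds the kernel of `f + t • g` into `K`.
  have : Function.Injective (φ ∘ₗ (ker (f + t • g)).subtype) := by
    rw [← ker_eq_bot, ker_eq_bot']
    rintro ⟨v, hv⟩ hφv
    replace hv : f v + t • g v = 0 := by simpa using hv
    replace hφv : φ v = 0 := by simpa using hφv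
    refine Subtype.ext (hinj' ?_)
    simpa [hφv] using hv
  simpa using finrank_le_finrank_of_injective this

/-- The rank of a linear map is preserved by field extensions. -/
lemma finrank_range_baseChange (A : Type*) [Field A] [Algebra K A] (f : End K V) :
    finrank A (range (f.baseChange A)) = finrank K (range f) := by
  have h : f.baseChange A =
      (range f).subtype.baseChange A ∘ₗ f.rangeRestrict.baseChange A := by
    rw [← baseChange_comp]
    rfl
  have hs : Function.Surjective (f.rangeRestrict.baseChange A) :=
    lTensor_surjective A f.surjective_rangeRestrict
  have hi : Function.Injective ((range f).subtype.baseChange A) :=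
    Module.Flat.lTensor_preserves_injective_linearMap _ (range f).injective_subtype
  rw [h, range_comp, range_eq_top.mpr hs, Submodule.map_top, finrank_range_of_inj hi,
    Module.finrank_baseChange]

end LinearMap

/-! ### Regular elements and Cartan subalgebras. -/

namespace LieAlgebra

open LieSubalgebra LieModule

section Field

variable {K L : Type*} [Field K] [LieRing L] [LieAlgebra K L] [FiniteDimensional K L]

/-- A line through a regular element meets the complement of the regular set in a finite set. -/
lemma finite_not_isRegular_add_smul {x y : L} (h : IsRegular K (x + y)) :
    {t : K | ¬ IsRegular K (x + t • y)}.Finite := by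
  classical
  let b := Module.Free.chooseBasis K L
  let P := (LinearMap.polyCharpoly (ad K L).toLinearMap b).coeff (LieAlgebra.rank K L)
  -- `p` restricts to the line the polynomial whose non-vanishing is regularity; it is non-zero at
  -- `t = 1`.
  let p : Polynomial K := MvPolynomial.aeval
    (fun i ↦ Polynomial.C (b.repr x i) + Polynomial.X * Polynomial.C (b.repr y i)) P
  have hp (t : K) : p.eval t = MvPolynomial.eval (b.repr (x + t • y)) P := by
    rw [← Polynomial.coe_aeval_eq_eval, ← AlgHom.comp_apply, MvPolynomial.comp_aeval,
      ← MvPolynomial.coe_aeval_eq_eval]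
    have : (fun i ↦ Polynomial.aeval t (Polynomial.C (b.repr x i) +
        Polynomial.X * Polynomial.C (b.repr y i))) = b.repr (x + t • y) := by
      ext i
      simp [mul_comm t]
    rw [this]
    rfl
  have hreg (t : K) : IsRegular K (x + t • y) ↔ p.eval t ≠ 0 := by
    rw [hp, isRegular_iff_coeff_polyCharpoly_rank_ne_zero K b]
  have hp0 : p ≠ 0 := by
    rintro h0
    have := (hreg 1).mp (by simpa using h)
    simp [h0] at this
  refine (Polynomial.finite_setOfPred_isRoot hp0).subset fun t ht ↦ ?_
  simpa [hreg] using ht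

/-- The Engel subalgebra of a regular element is a Cartan subalgebra. -/
lemma IsRegular.isCartanSubalgebra_engel [Infinite K] {x : L} (hx : IsRegular K x) :
    IsCartanSubalgebra (engel K x) := by
  refine ⟨?_, normalizer_engel _ _⟩
  apply isNilpotent_of_forall_le_engel
  intro y hy
  let Ex : {engel K z | z ∈ engel K x} := ⟨engel K x, x, self_mem_engel _ _, rfl⟩
  suffices IsBot Ex from @this ⟨engel K y, y, hy, rfl⟩
  apply engel_isBot_of_isMin
    (Cardinal.natCast_le_aleph0.trans <| Cardinal.infinite_iff.mp ‹Infinite K›)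
    (engel K x) Ex le_rfl
  rintro ⟨_, y, hy, rfl⟩ hyx
  suffices finrank K (engel K x) ≤ finrank K (engel K y) by
    suffices engel K y = engel K x from this.ge
    apply LieSubalgebra.toSubmodule_injective
    exact Submodule.eq_of_le_of_finrank_le hyx this
  rw [(isRegular_iff_finrank_engel_eq_rank K x).mp hx]
  apply rank_le_finrank_engel

/-- If some centralizer in a Lie algebra with non-degenerate Killing form is a line, then there is
a Cartan subalgebra of dimension at most one. -/
lemma exists_isCartanSubalgebra_finrank_le_one [Infinite K] [IsKilling K L] {x : L}
    (hx : finrank K (LinearMap.ker (ad K L x)) = 1) :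
    ∃ H : LieSubalgebra K L, H.IsCartanSubalgebra ∧ finrank K H ≤ 1 := by
  obtain ⟨y, hy⟩ := exists_isRegular K L
  -- The line runs from `x` at `t = 0`, where the kernel is a line, to the regular `y` at `t = 1`;
  -- each property fails for only finitely many `t`.
  have h₁ := finite_not_isRegular_add_smul (K := K) (x := x) (y := y - x) (by simpa using hy)
  have h₂ := LinearMap.finite_one_lt_finrank_ker_add_smul hx (ad K L (y - x))
  obtain ⟨t, ht⟩ := (h₁.union h₂).exists_notMem
  simp only [Set.mem_union, Set.mem_ofPred_eq, not_or, not_not, not_lt] at ht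
  set z := x + t • (y - x) with hz
  have hC := IsRegular.isCartanSubalgebra_engel ht.1
  refine ⟨engel K z, hC, ?_⟩
  have hz' : ad K L x + t • ad K L (y - x) = ad K L z := by simp [hz]
  rw [hz'] at ht
  -- Cartan subalgebras of a Killing algebra are abelian, so `engel K z` lies in the centralizer of
  -- `z`.
  refine le_trans (Submodule.finrank_mono (s := (engel K z).toSubmodule) fun w hw ↦ ?_) ht.2
  have := trivial_lie_zero (engel K z) (engel K z) ⟨z, self_mem_engel K z⟩ ⟨w, hw⟩
  simpa using congrArg Subtype.val this

end Field

/-! ### Root space decomposition in rank at most one. -/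

section AlgClosed

variable {K L : Type*} [Field K] [IsAlgClosed K] [CharZero K] [LieRing L] [LieAlgebra K L]
  [FiniteDimensional K L] [IsKilling K L]

/-- A Killing Lie algebra with a Cartan subalgebra of dimension at most one has dimension at most
three. -/
lemma finrank_le_three_of_finrank_cartan_le_one (H : LieSubalgebra K L) [H.IsCartanSubalgebra]
    (hH : finrank K H ≤ 1) : finrank K L ≤ 3 := by
  have htop := congrArg LieSubmodule.toSubmodule (cartan_sup_iSup_rootSpace_eq_top H)
  by_cases hex : ∃ α : Weight K H L, α.IsNonZero
  · obtain ⟨α, hα⟩ := hex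
    have hdual : finrank K (Dual K H) = 1 := by
      refine le_antisymm (by rwa [Subspace.dual_finrank_eq]) ?_
      have : Nontrivial (Dual K H) := ⟨α.toLinear, 0, by simpa using hα⟩
      exact finrank_pos
    -- The dual of `H` is a line, so every root is a multiple of `α`, hence `±α`.
    have hβ (β : Weight K H L) (hβ : β.IsNonZero) : β = -α ∨ β = α := by
      obtain ⟨c, hc⟩ := (finrank_eq_one_iff_of_nonzero' α.toLinear (by simpa using hα)).mp hdual
        β.toLinear
      exact IsKilling.eq_neg_or_eq_of_eq_smul α β hβ c
        (funext fun h ↦ (LinearMap.congr_fun hc h).symm)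
    have hle : (⊤ : Submodule K L) ≤
        H.toSubmodule ⊔ ((rootSpace H α).toSubmodule ⊔ (rootSpace H (-α)).toSubmodule) := by
      rw [← LieSubmodule.top_toSubmodule (R := K) (L := H), ← htop, LieSubmodule.sup_toSubmodule,
        LieSubmodule.iSup_toSubmodule]
      refine sup_le_sup le_rfl (iSup_le fun β ↦ ?_)
      rw [LieSubmodule.iSup_toSubmodule]
      refine iSup_le fun h ↦ ?_
      rcases hβ β h with rfl | rfl
      · exact le_sup_right
      · exact le_sup_left
    have h1 := IsKilling.finrank_rootSpace_eq_one α hα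
    have h2 := IsKilling.finrank_rootSpace_eq_one (-α) (by simpa using hα)
    have h3 := Submodule.finrank_mono hle
    rw [finrank_top] at h3
    have h4 := Submodule.finrank_add_le_finrank_add_finrank H.toSubmodule
      ((rootSpace H α).toSubmodule ⊔ (rootSpace H (-α)).toSubmodule)
    have h5 := Submodule.finrank_add_le_finrank_add_finrank (rootSpace H α).toSubmodule
      (rootSpace H (-α)).toSubmodule
    change finrank K (rootSpace H α).toSubmodule = 1 at h1
    change finrank K (rootSpace H (-α)).toSubmodule = 1 at h2
    change finrank K H.toSubmodule ≤ 1 at hH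
    omega
  · have : H.toSubmodule = ⊤ := by
      push Not at hex
      simpa [hex] using htop
    have h := finrank_top K L
    rw [← this] at h
    change finrank K H.toSubmodule ≤ 1 at hH
    omega

end AlgClosed

/-! ### Descent from the algebraic closure. -/

section BaseChange

open scoped TensorProduct

variable (K A L : Type*) [Field K] [Field A] [Algebra K A] [LieRing L] [LieAlgebra K L]
  [FiniteDimensional K L]

/-- Non-degeneracy of the Killing form is preserved by field extensions. -/
instance instIsKillingBaseChange [IsKilling K L] : IsKilling A (A ⊗[K] L) where
  killingCompl_top_eq_bot := by
    let b := Module.Free.chooseBasis K L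
    have h1 := (LinearMap.BilinForm.nondegenerate_iff_det_ne_zero b).mp
      (IsKilling.killingForm_nondegenerate K L)
    have h2 : LinearMap.BilinForm.toMatrix (b.baseChange A) (killingForm A (A ⊗[K] L)) =
        (LinearMap.BilinForm.toMatrix b (killingForm K L)).map (algebraMap K A) := by
      ext i j
      simp [LinearMap.BilinForm.toMatrix_apply, Algebra.algebraMap_eq_smul_one]
    have h3 : (killingForm A (A ⊗[K] L)).Nondegenerate := by
      rw [LinearMap.BilinForm.nondegenerate_iff_det_ne_zero (b.baseChange A), h2,
        ← RingHom.mapMatrix_apply, ← RingHom.map_det]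
      simpa using h1
    rw [_root_.eq_bot_iff]
    intro x hx
    rw [LieIdeal.mem_killingCompl] at hx
    exact h3.2 x fun y ↦ hx y trivial

variable {K L}

/-- If some centralizer in a Killing Lie algebra in characteristic zero is a line, then the
dimension is at most three. -/
theorem finrank_le_three_of_finrank_ker_ad_eq_one [CharZero K] [IsKilling K L] {x : L}
    (hx : finrank K (LinearMap.ker (ad K L x)) = 1) : finrank K L ≤ 3 := by
  let A := AlgebraicClosure K
  have hker : finrank A (LinearMap.ker (ad A (A ⊗[K] L) (1 ⊗ₜ x))) = 1 := by
    have h1 : ad A (A ⊗[K] L) (1 ⊗ₜ x) = (ad K L x).baseChange A :=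
      LieModule.toEnd_baseChange K A L L x
    have h2 := (ad K L x).finrank_range_add_finrank_ker
    have h3 := (ad A (A ⊗[K] L) (1 ⊗ₜ x)).finrank_range_add_finrank_ker
    rw [Module.finrank_baseChange] at h3
    have h4 : finrank A (LinearMap.range (ad A (A ⊗[K] L) (1 ⊗ₜ x))) =
        finrank K (LinearMap.range (ad K L x)) := by
      rw [h1, LinearMap.finrank_range_baseChange]
    omega
  obtain ⟨H, hH, hH1⟩ := exists_isCartanSubalgebra_finrank_le_one hker
  simpa [Module.finrank_baseChange] using finrank_le_three_of_finrank_cartan_le_one H hH1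

end BaseChange

end LieAlgebra

/-! ### Normal form of three-dimensional Killing algebras over the reals. -/

namespace LieAlgebra

/-- Two Lie algebras with bases indexed by `Fin 3` and the same diagonal structure constants are
isomorphic. -/
lemma nonempty_lieEquiv_of_basis {R L L' : Type*} [CommRing R] [LieRing L] [LieAlgebra R L]
    [LieRing L'] [LieAlgebra R L'] (e : Module.Basis (Fin 3) R L)
    (u : Module.Basis (Fin 3) R L') (a b c : R)
    (he₀₁ : ⁅e 0, e 1⁆ = a • e 2) (he₁₂ : ⁅e 1, e 2⁆ = b • e 0) (he₂₀ : ⁅e 2, e 0⁆ = c • e 1)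
    (hu₀₁ : ⁅u 0, u 1⁆ = a • u 2) (hu₁₂ : ⁅u 1, u 2⁆ = b • u 0) (hu₂₀ : ⁅u 2, u 0⁆ = c • u 1) :
    Nonempty (L ≃ₗ⁅R⁆ L') := by
  let f : L ≃ₗ[R] L' := e.equiv u (Equiv.refl _)
  have hf (i : Fin 3) : f (e i) = u i := by simp [f]
  have he₁₀ : ⁅e 1, e 0⁆ = -(a • e 2) := by rw [← lie_skew, he₀₁]
  have he₂₁ : ⁅e 2, e 1⁆ = -(b • e 0) := by rw [← lie_skew, he₁₂]
  have he₀₂ : ⁅e 0, e 2⁆ = -(c • e 1) := by rw [← lie_skew, he₂₀]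
  have hu₁₀ : ⁅u 1, u 0⁆ = -(a • u 2) := by rw [← lie_skew, hu₀₁]
  have hu₂₁ : ⁅u 2, u 1⁆ = -(b • u 0) := by rw [← lie_skew, hu₁₂]
  have hu₀₂ : ⁅u 0, u 2⁆ = -(c • u 1) := by rw [← lie_skew, hu₂₀]
  have key : (LieModule.toEnd R L L : L →ₗ[R] End R L).compr₂ (f : L →ₗ[R] L') =
      (LieModule.toEnd R L' L' : L' →ₗ[R] End R L').compl₁₂ (f : L →ₗ[R] L') (f : L →ₗ[R] L') := by
    refine e.ext fun i ↦ e.ext fun j ↦ ?_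
    fin_cases i <;> fin_cases j <;> simp [*]
  exact ⟨{ f with map_lie' := fun {x y} ↦ LinearMap.congr_fun₂ key x y }⟩

section Real

variable {L : Type*} [LieRing L] [LieAlgebra ℝ L]

/-- A basis with diagonal structure constants, two of which have the same sign, can be rescaled so
that the structure constants are `±1`, `1`, `1`. -/
lemma exists_basis_rescale (e : Module.Basis (Fin 3) ℝ L) {a b c : ℝ} (ha : a ≠ 0)
    (hbc : 0 < b * c)
    (h₀₁ : ⁅e 0, e 1⁆ = a • e 2) (h₁₂ : ⁅e 1, e 2⁆ = b • e 0) (h₂₀ : ⁅e 2, e 0⁆ = c • e 1) :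
    ∃ (u : Module.Basis (Fin 3) ℝ L) (ε : ℝ), (ε = 1 ∨ ε = -1) ∧
      ⁅u 0, u 1⁆ = ε • u 2 ∧ ⁅u 1, u 2⁆ = u 0 ∧ ⁅u 2, u 0⁆ = u 1 := by
  have hb : b ≠ 0 := left_ne_zero_of_mul hbc.ne'
  -- With `u i = k i • e i`, the last two brackets require `k 0 = b * k₁ * k₂` and `b * c * k₂ ^ 2 =
  -- 1`; the first constant is then `a * b * k₁ ^ 2`, and `k₁` makes it `±1`.
  set k₂ : ℝ := (√(b * c))⁻¹ with hk₂
  set k₁ : ℝ := (√|a * b|)⁻¹ with hk₁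
  have hk₂0 : k₂ ≠ 0 := inv_ne_zero (Real.sqrt_pos.mpr hbc).ne'
  have hk₁0 : k₁ ≠ 0 := inv_ne_zero (Real.sqrt_pos.mpr (abs_pos.mpr (mul_ne_zero ha hb))).ne'
  have hk₂sq : b * c * k₂ ^ 2 = 1 := by
    rw [hk₂, inv_pow, Real.sq_sqrt hbc.le, mul_inv_cancel₀ hbc.ne']
  have hk₁sq : |a * b| * k₁ ^ 2 = 1 := by
    rw [hk₁, inv_pow, Real.sq_sqrt (abs_nonneg _),
      mul_inv_cancel₀ (abs_pos.mpr (mul_ne_zero ha hb)).ne']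
  let k : Fin 3 → ℝ := ![b * k₁ * k₂, k₁, k₂]
  have hk : ∀ i, IsUnit (k i) := by
    intro i
    fin_cases i <;> simp [k, hb, hk₁0, hk₂0]
  refine ⟨e.isUnitSMul hk, a * b * k₁ ^ 2, ?_, ?_, ?_, ?_⟩
  · rcases abs_choice (a * b) with h | h
    · left; rw [← h, hk₁sq]
    · right; rw [← hk₁sq, h]; ring
  · simp only [Module.Basis.isUnitSMul_apply, k, smul_lie, lie_smul, h₀₁, smul_smul,
      Matrix.cons_val]
    congr 1; ring
  · simp only [Module.Basis.isUnitSMul_apply, k, smul_lie, lie_smul, h₁₂, smul_smul,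
      Matrix.cons_val]
    congr 1; ring
  · simp only [Module.Basis.isUnitSMul_apply, k, smul_lie, lie_smul, h₂₀, smul_smul,
      Matrix.cons_val]
    congr 1; linear_combination k₁ * hk₂sq

/-- A basis with non-zero diagonal structure constants can be rescaled and cyclically permuted so
that the structure constants are `±1`, `1`, `1`. -/
lemma exists_basis_normalized (e : Module.Basis (Fin 3) ℝ L) {a b c : ℝ} (ha : a ≠ 0) (hb : b ≠ 0)
    (hc : c ≠ 0)
    (h₀₁ : ⁅e 0, e 1⁆ = a • e 2) (h₁₂ : ⁅e 1, e 2⁆ = b • e 0) (h₂₀ : ⁅e 2, e 0⁆ = c • e 1) :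
    ∃ (u : Module.Basis (Fin 3) ℝ L) (ε : ℝ), (ε = 1 ∨ ε = -1) ∧
      ⁅u 0, u 1⁆ = ε • u 2 ∧ ⁅u 1, u 2⁆ = u 0 ∧ ⁅u 2, u 0⁆ = u 1 := by
  have hsign : 0 < b * c ∨ 0 < c * a ∨ 0 < a * b := by
    rcases ha.lt_or_gt with h0 | h0 <;> rcases hb.lt_or_gt with h1 | h1 <;>
      rcases hc.lt_or_gt with h2 | h2 <;>
      simp only [mul_pos_iff, h0, h1, h2, true_and, and_true, true_or, or_true]
  have h0 : finRotate 3 0 = 1 := by decide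
  have h1 : finRotate 3 1 = 2 := by decide
  have h2 : finRotate 3 2 = 0 := by decide
  let rot₁ := e.reindex (finRotate 3).symm
  have hrot₁ (i : Fin 3) : rot₁ i = e (finRotate 3 i) := by
    simp only [rot₁, Module.Basis.reindex_apply, Equiv.symm_symm]
  let rot₂ := rot₁.reindex (finRotate 3).symm
  have hrot₂ (i : Fin 3) : rot₂ i = e (finRotate 3 (finRotate 3 i)) := by
    simp only [rot₂, Module.Basis.reindex_apply, Equiv.symm_symm, hrot₁]
  rcases hsign with h | h | h
  · exact exists_basis_rescale e ha h h₀₁ h₁₂ h₂₀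
  · exact exists_basis_rescale rot₁ hb h (by simpa only [hrot₁, h0, h1, h2] using h₁₂)
      (by simpa only [hrot₁, h0, h1, h2] using h₂₀) (by simpa only [hrot₁, h0, h1, h2] using h₀₁)
  · exact exists_basis_rescale rot₂ hc h (by simpa only [hrot₂, h0, h1, h2] using h₂₀)
      (by simpa only [hrot₂, h0, h1, h2] using h₀₁) (by simpa only [hrot₂, h0, h1, h2] using h₁₂)

/-- A three-dimensional real Lie algebra with non-degenerate Killing form has a basis with
structure constants `±1`, `1`, `1`. -/
lemma exists_basis_of_finrank_eq_three [FiniteDimensional ℝ L] [IsKilling ℝ L]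
    (hL : finrank ℝ L = 3) :
    ∃ (u : Module.Basis (Fin 3) ℝ L) (ε : ℝ), (ε = 1 ∨ ε = -1) ∧
      ⁅u 0, u 1⁆ = ε • u 2 ∧ ⁅u 1, u 2⁆ = u 0 ∧ ⁅u 2, u 0⁆ = u 1 := by
  set B := killingForm ℝ L with hB
  have hsymm : LinearMap.IsSymm B := LieModule.traceForm_isSymm ℝ L L
  have hnd : B.Nondegenerate := IsKilling.killingForm_nondegenerate ℝ L
  have hinv (x y z : L) : B ⁅x, y⁆ z = B x ⁅y, z⁆ := LieModule.traceForm_apply_lie_apply ℝ L L x y z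
  obtain ⟨v, hv⟩ := LinearMap.BilinForm.exists_orthogonal_basis hsymm
  let e : Module.Basis (Fin 3) ℝ L := v.reindex (finCongr hL)
  have hne : ∀ i j, i ≠ j → B (e i) (e j) = 0 := by
    intro i j hij
    have : (finCongr hL).symm i ≠ (finCongr hL).symm j := by simpa using hij
    simpa [e] using! hv this
  have hd : ∀ i, B (e i) (e i) ≠ 0 := by
    intro i
    have := LinearMap.IsOrthoᵢ.not_isOrtho_basis_self_of_separatingLeft hv hnd.1
      ((finCongr hL).symm i)
    simpa [e] using! this
  have hcoord (w : L) (i : Fin 3) : e.repr w i = B w (e i) / B (e i) (e i) := by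
    rw [eq_div_iff (hd i)]
    conv_rhs => rw [← e.sum_repr w]
    rw [map_sum, LinearMap.sum_apply, Finset.sum_eq_single i]
    · simp
    · intro j _ hj
      simp [hne j i hj]
    · simp
  -- By invariance `⁅x, y⁆` is orthogonal to `x` and `y`, so each bracket of two basis vectors is a
  -- multiple of the third; by cyclicity one number `T` governs all three.
  have hself (x y : L) : B ⁅x, y⁆ y = 0 := by rw [hinv, lie_self, map_zero]
  have hself' (x y : L) : B ⁅x, y⁆ x = 0 := by
    rw [← lie_skew, map_neg, LinearMap.neg_apply, hself, neg_zero]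
  have hcyc (x y z : L) : B ⁅x, y⁆ z = B ⁅y, z⁆ x := by
    rw [hinv]; exact hsymm.eq _ _
  set T := B ⁅e 0, e 1⁆ (e 2) with hT
  have h₀₁ : ⁅e 0, e 1⁆ = (T / B (e 2) (e 2)) • e 2 := by
    conv_lhs => rw [← e.sum_repr ⁅e 0, e 1⁆]
    simp [Fin.sum_univ_three, hcoord, hself, hself', hT]
  have h₁₂ : ⁅e 1, e 2⁆ = (T / B (e 0) (e 0)) • e 0 := by
    conv_lhs => rw [← e.sum_repr ⁅e 1, e 2⁆]
    simp [Fin.sum_univ_three, hcoord, hself, hself', hT, hcyc (e 0)]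
  have h₂₀ : ⁅e 2, e 0⁆ = (T / B (e 1) (e 1)) • e 1 := by
    conv_lhs => rw [← e.sum_repr ⁅e 2, e 0⁆]
    simp [Fin.sum_univ_three, hcoord, hself, hT, hcyc (e 2)]
  have hT0 : T ≠ 0 := by
    intro h
    rw [h, zero_div, zero_smul] at h₀₁ h₁₂ h₂₀
    have h₀₂ : ⁅e 0, e 2⁆ = 0 := by rw [← lie_skew, h₂₀, neg_zero]
    have had : ad ℝ L (e 0) = 0 := by
      refine e.ext fun i ↦ ?_
      fin_cases i <;> simp [h₀₁, h₀₂]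
    refine hd 0 ?_
    rw [hB, killingForm_apply_apply, had]
    simp
  exact exists_basis_normalized e (div_ne_zero hT0 (hd 2)) (div_ne_zero hT0 (hd 0))
    (div_ne_zero hT0 (hd 1)) h₀₁ h₁₂ h₂₀

end Real

end LieAlgebra

/-! ### The models `su2` and `sl₂(ℝ)`. -/

namespace LcsLie

/-- `su2` has a basis with structure constants `1`, `1`, `1`. -/
lemma exists_basis_su2 : ∃ u : Module.Basis (Fin 3) ℝ su2,
    ⁅u 0, u 1⁆ = u 2 ∧ ⁅u 1, u 2⁆ = u 0 ∧ ⁅u 2, u 0⁆ = u 1 := by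
  let I := Complex.I
  -- Halves of the quaternion units, so that the factor 2 in their commutators cancels.
  let m : Fin 3 → su2 :=
    ![⟨!![I / 2, 0; 0, -I / 2], by
        constructor
        · ext i j
          fin_cases i <;> fin_cases j <;> simp [I, neg_div]
        · simp [Matrix.trace_fin_two, neg_div]⟩,
      ⟨!![0, 1 / 2; -1 / 2, 0], by
        constructor
        · ext i j
          fin_cases i <;> fin_cases j <;> simp [neg_div]
        · simp [Matrix.trace_fin_two]⟩,
      ⟨!![0, I / 2; I / 2, 0], by
        constructor
        · ext i j
          fin_cases i <;> fin_cases j <;> simp [I, neg_div]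
        · simp [Matrix.trace_fin_two]⟩]
  have hcomb (g : Fin 3 → ℝ) : ((∑ i, g i • m i : su2) : Matrix (Fin 2) (Fin 2) ℂ) =
      !![g 0 * (I / 2), g 1 / 2 + g 2 * (I / 2); -(g 1 / 2) + g 2 * (I / 2), -(g 0 * (I / 2))] := by
    ext i j
    fin_cases i <;> fin_cases j <;>
      simp [Fin.sum_univ_three, m, div_eq_mul_inv]
  have hli : LinearIndependent ℝ m := by
    rw [Fintype.linearIndependent_iff]
    intro g hg
    have h := hcomb g
    rw [hg] at h
    have h00 := congrFun (congrFun h 0) 0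
    have h01 := congrFun (congrFun h 0) 1
    simp [Complex.ext_iff, I] at h00 h01
    intro i
    fin_cases i
    · change g 0 = 0; linarith
    · change g 1 = 0; linarith [h01.1]
    · change g 2 = 0; linarith [h01.2]
  have hsp : ⊤ ≤ Submodule.span ℝ (Set.range m) := by
    rintro ⟨A, hA, hA'⟩ -
    rw [Submodule.mem_span_range_iff_exists_fun]
    refine ⟨![2 * (A 0 0).im, 2 * (A 0 1).re, 2 * (A 0 1).im], Subtype.ext ?_⟩
    rw [hcomb]
    have h00 := congrFun (congrFun hA 0) 0
    have h01 := congrFun (congrFun hA 1) 0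
    rw [Matrix.trace_fin_two] at hA'
    simp only [Matrix.conjTranspose_apply, Matrix.neg_apply, Complex.ext_iff, Complex.star_def,
      Complex.conj_re, Complex.conj_im, Complex.neg_re, Complex.neg_im, Complex.add_re,
      Complex.add_im, Complex.zero_re, Complex.zero_im] at h00 h01 hA'
    ext i j
    apply Complex.ext <;> fin_cases i <;> fin_cases j <;> simp [I] <;> linarith
  refine ⟨Module.Basis.mk hli hsp, ?_, ?_, ?_⟩ <;>
  · rw [Subtype.ext_iff, LieSubalgebra.coe_bracket]
    simp only [Basis.mk_apply, Ring.lie_def]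
    ext i j
    fin_cases i <;> fin_cases j <;>
      simp [m, Complex.ext_iff, I] <;> norm_num

/-- `sl₂(ℝ)` has a basis with structure constants `-1`, `1`, `1`. -/
lemma exists_basis_sl2 : ∃ u : Module.Basis (Fin 3) ℝ (LieAlgebra.SpecialLinear.sl (Fin 2) ℝ),
    ⁅u 0, u 1⁆ = -u 2 ∧ ⁅u 1, u 2⁆ = u 0 ∧ ⁅u 2, u 0⁆ = u 1 := by
  let m : Fin 3 → LieAlgebra.SpecialLinear.sl (Fin 2) ℝ :=
    ![⟨!![0, 1 / 2; 1 / 2, 0], by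
        simp [LieAlgebra.SpecialLinear.sl, Matrix.trace_fin_two]⟩,
      ⟨!![1 / 2, 0; 0, -1 / 2], by
        simp [LieAlgebra.SpecialLinear.sl, Matrix.trace_fin_two, neg_div]⟩,
      ⟨!![0, 1 / 2; -1 / 2, 0], by
        simp [LieAlgebra.SpecialLinear.sl, Matrix.trace_fin_two]⟩]
  have hcomb (g : Fin 3 → ℝ) :
      ((∑ i, g i • m i : LieAlgebra.SpecialLinear.sl (Fin 2) ℝ) : Matrix (Fin 2) (Fin 2) ℝ) =
      !![g 1 / 2, g 0 / 2 + g 2 / 2; g 0 / 2 - g 2 / 2, -(g 1 / 2)] := by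
    ext i j
    fin_cases i <;> fin_cases j <;>
      simp [Fin.sum_univ_three, m, div_eq_mul_inv, sub_eq_add_neg]
  have hli : LinearIndependent ℝ m := by
    rw [Fintype.linearIndependent_iff]
    intro g hg
    have h := hcomb g
    rw [hg] at h
    have h00 := congrFun (congrFun h 0) 0
    have h01 := congrFun (congrFun h 0) 1
    have h10 := congrFun (congrFun h 1) 0
    simp at h00 h01 h10
    intro i
    fin_cases i
    · change g 0 = 0; linarith
    · change g 1 = 0; linarith
    · change g 2 = 0; linarith
  have hsp : ⊤ ≤ Submodule.span ℝ (Set.range m) := by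
    rintro ⟨A, hA⟩ -
    rw [Submodule.mem_span_range_iff_exists_fun]
    refine ⟨![A 0 1 + A 1 0, 2 * A 0 0, A 0 1 - A 1 0], Subtype.ext ?_⟩
    rw [hcomb]
    replace hA : A.trace = 0 := hA
    rw [Matrix.trace_fin_two] at hA
    ext i j
    fin_cases i <;> fin_cases j <;> simp <;> linarith
  refine ⟨Module.Basis.mk hli hsp, ?_, ?_, ?_⟩ <;>
  · rw [Subtype.ext_iff, LieSubalgebra.coe_bracket]
    simp only [Basis.mk_apply, Ring.lie_def]
    ext i j
    fin_cases i <;> fin_cases j <;> simp [m] <;> norm_num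

/-- A three-dimensional real Lie algebra with non-degenerate Killing form is isomorphic to `su2` or
to `sl₂(ℝ)`. -/
theorem nonempty_lieEquiv_su2_or_sl2 {L : Type*} [LieRing L] [LieAlgebra ℝ L]
    [FiniteDimensional ℝ L] [LieAlgebra.IsKilling ℝ L] (hL : finrank ℝ L = 3) :
    Nonempty (L ≃ₗ⁅ℝ⁆ su2) ∨ Nonempty (L ≃ₗ⁅ℝ⁆ LieAlgebra.SpecialLinear.sl (Fin 2) ℝ) := by
  obtain ⟨e, ε, rfl | rfl, h₀₁, h₁₂, h₂₀⟩ := LieAlgebra.exists_basis_of_finrank_eq_three hL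
  · obtain ⟨u, hu₀₁, hu₁₂, hu₂₀⟩ := exists_basis_su2
    exact .inl (LieAlgebra.nonempty_lieEquiv_of_basis e u 1 1 1 h₀₁ (by simpa using h₁₂)
      (by simpa using h₂₀) (by simpa using hu₀₁) (by simpa using hu₁₂) (by simpa using hu₂₀))
  · obtain ⟨u, hu₀₁, hu₁₂, hu₂₀⟩ := exists_basis_sl2
    exact .inr (LieAlgebra.nonempty_lieEquiv_of_basis e u (-1) 1 1 h₀₁ (by simpa using h₁₂)
      (by simpa using h₂₀) (by simpa using hu₀₁) (by simpa using hu₁₂) (by simpa using hu₂₀))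

end LcsLie

/-! ### The semisimple quotient by the center, and closed forms on Killing algebras. -/

namespace LieAlgebra

section QuotientCenter

variable (R L : Type*) [CommRing R] [LieRing L] [LieAlgebra R L]

/-- The projection of a Lie algebra onto the quotient by its center. -/
def quotientCenterMk : L →ₗ⁅R⁆ L ⧸ center R L where
  toLinearMap := (LieSubmodule.Quotient.mk' (center R L)).toLinearMap
  map_lie' := LieSubmodule.Quotient.mk_bracket (I := center R L) _ _

lemma quotientCenterMk_surjective : Function.Surjective (quotientCenterMk R L) :=
  LieSubmodule.Quotient.surjective_mk' (center R L)

variable {R L} in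
lemma quotientCenterMk_eq_zero {x : L} : quotientCenterMk R L x = 0 ↔ x ∈ center R L :=
  LieSubmodule.Quotient.mk_eq_zero (center R L)

/-- The quotient of a reductive Lie algebra by its center has trivial radical. -/
instance instHasTrivialRadicalQuotientCenter [HasCentralRadical R L] [IsNoetherian R L] :
    HasTrivialRadical R (L ⧸ center R L) := by
  rw [hasTrivialRadical_iff_no_abelian_ideals]
  intro J hJ
  let π := quotientCenterMk R L
  -- The preimage `I` of an abelian ideal has `⁅I, I⁆` central, so it is solvable and lies in the
  -- radical, which is the center.
  let I : LieIdeal R L := J.comap π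
  have hI {x : L} : x ∈ I ↔ π x ∈ J := LieIdeal.mem_comap
  have hII : ⁅I, I⁆ ≤ center R L := by
    rw [LieSubmodule.lieIdeal_oper_eq_span, LieSubmodule.lieSpan_le]
    rintro _ ⟨⟨x, hx⟩, ⟨y, hy⟩, rfl⟩
    rw [SetLike.mem_coe, ← quotientCenterMk_eq_zero, LieHom.map_lie]
    exact congrArg Subtype.val (trivial_lie_zero J J ⟨π x, hI.mp hx⟩ ⟨π y, hI.mp hy⟩)
  have hsol : IsSolvable I := by
    refine IsSolvable.mk (R := R) (k := 2) ((LieIdeal.derivedSeries_eq_bot_iff I 2).mpr ?_)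
    rw [derivedSeriesOfIdeal_succ, derivedSeriesOfIdeal_succ, derivedSeriesOfIdeal_zero,
      LieSubmodule.lie_eq_bot_iff]
    exact fun x _ m hm ↦ hII hm x
  rw [LieIdeal.solvable_iff_le_radical, HasCentralRadical.radical_eq_center] at hsol
  rw [eq_bot_iff]
  intro x hx
  obtain ⟨X, rfl⟩ := quotientCenterMk_surjective R L x
  exact quotientCenterMk_eq_zero.mpr (hsol (hI.mpr hx))

end QuotientCenter

namespace IsKilling

variable {K L : Type*} [Field K] [LieRing L] [LieAlgebra K L] [FiniteDimensional K L]
  [IsKilling K L]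

/-- A Killing Lie algebra has no non-zero closed `1`-forms. -/
lemma dual_eq_zero_of_forall_apply_lie {φ : Dual K L} (h : ∀ x y : L, φ ⁅x, y⁆ = 0) : φ = 0 := by
  have hnd := killingForm_nondegenerate K L
  obtain ⟨t, rfl⟩ := (LinearMap.BilinForm.toDual _ hnd).surjective φ
  simp only [LinearMap.BilinForm.toDual_def] at h
  -- By invariance of the Killing form, the form dual to `t` is closed only if `t` is central.
  have ht : t ∈ center K L := fun x ↦ hnd.1 _ fun y ↦ by
    rw [← lie_skew, map_neg, LinearMap.neg_apply, neg_eq_zero, ← h x y]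
    exact LieModule.traceForm_apply_lie_apply K L L t x y
  rw [center_eq_bot, LieSubmodule.mem_bot] at ht
  rw [ht, map_zero]

/-- Every closed `2`-form on a Killing Lie algebra is exact. -/
lemma exists_eq_killingForm_lie_of_cocycle (ω : LinearMap.BilinForm K L)
    (hskew : ∀ x y, ω x y = -ω y x)
    (hω : ∀ x y z, ω ⁅x, y⁆ z + ω ⁅y, z⁆ x + ω ⁅z, x⁆ y = 0) :
    ∃ d : L, ∀ x y, ω x y = killingForm K L ⁅d, x⁆ y := by
  have hnd := killingForm_nondegenerate K L
  let f : L →ₗ[K] L := (LinearMap.BilinForm.toDual _ hnd).symm ∘ₗ ω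
  have hf (x y : L) : killingForm K L (f x) y = ω x y :=
    LinearMap.BilinForm.apply_toDual_symm_apply (hB := hnd) _ _
  have hinv (x y z : L) : killingForm K L ⁅x, y⁆ z = -killingForm K L y ⁅x, z⁆ := by
    rw [← lie_skew, map_neg, LinearMap.neg_apply]
    exact congrArg _ (LieModule.traceForm_apply_lie_apply K L L y x z)
  -- The cocycle identity for `ω` is the Leibniz rule for `f`; derivations of a Killing algebra are
  -- inner.
  let D : LieDerivation K L L :=
    { toLinearMap := f
      leibniz' := fun x y ↦ by
        rw [← sub_eq_zero]
        refine hnd.1 _ fun z ↦ ?_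
        simp only [map_sub, LinearMap.sub_apply, hinv, hf]
        have h1 := hω x y z
        rw [hskew ⁅y, z⁆ x, ← lie_skew z x, map_neg, LinearMap.neg_apply, hskew ⁅x, z⁆ y] at h1
        linear_combination h1 }
  obtain ⟨d, hd⟩ := LieDerivation.IsKilling.exists_eq_ad D
  refine ⟨d, fun x y ↦ ?_⟩
  have hDx : f x = ⁅d, x⁆ := by
    rw [← LieDerivation.ad_apply_apply (R := K), hd]
    rfl
  rw [← hf, hDx]

end IsKilling

end LieAlgebra

/-! ### Lcs structures on reductive algebras. -/

namespace LcsLie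

variable {𝔤 : Type*} [LieRing 𝔤] [LieAlgebra ℝ 𝔤] {Ω : LinearMap.BilinForm ℝ 𝔤}
  {ϑ : Module.Dual ℝ 𝔤}

open LieAlgebra

lemma IsLcs.lee_lie (h : IsLcs Ω ϑ) (X Y : 𝔤) : ϑ ⁅X, Y⁆ = 0 := by
  simpa [d₁] using h.d_lee X Y

/-- The Lee form as a Lie algebra homomorphism. -/
def IsLcs.leeHom (h : IsLcs Ω ϑ) : 𝔤 →ₗ⁅ℝ⁆ ℝ where
  toLinearMap := ϑ
  map_lie' := by
    intro X Y
    change ϑ ⁅X, Y⁆ = ⁅ϑ X, ϑ Y⁆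
    rw [h.lee_lie, Ring.lie_def, mul_comm, sub_self]

/-- The Lee form does not vanish on the center of a reductive Lie algebra. -/
lemma IsLcs.exists_mem_center_lee_eq_one [FiniteDimensional ℝ 𝔤] [HasCentralRadical ℝ 𝔤]
    (h : IsLcs Ω ϑ) (hϑ : ϑ ≠ 0) : ∃ Z ∈ center ℝ 𝔤, ϑ Z = 1 := by
  by_contra! hZ
  have hker : ∀ Z ∈ center ℝ 𝔤, ϑ Z = 0 := by
    intro Z hZc
    by_contra h0
    exact hZ ((ϑ Z)⁻¹ • Z) (SMulMemClass.smul_mem _ hZc) (by simp [h0])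
  -- If `ϑ` vanished on the center it would descend to a closed 1-form on the semisimple quotient.
  let φ : Module.Dual ℝ (𝔤 ⧸ center ℝ 𝔤) := (center ℝ 𝔤).toSubmodule.liftQ ϑ hker
  have hφ (X : 𝔤) : φ (quotientCenterMk ℝ 𝔤 X) = ϑ X := Submodule.liftQ_apply _ _ _
  have hφ0 : φ = 0 := by
    refine IsKilling.dual_eq_zero_of_forall_apply_lie fun x y ↦ ?_
    obtain ⟨X, rfl⟩ := quotientCenterMk_surjective ℝ 𝔤 x
    obtain ⟨Y, rfl⟩ := quotientCenterMk_surjective ℝ 𝔤 y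
    rw [← LieHom.map_lie, hφ, h.lee_lie]
  refine hϑ (LinearMap.ext fun X ↦ ?_)
  rw [← hφ, hφ0]
  simp

/-- If the Lee form takes the value `1` on a central element `Z`, then `Ω` is determined by the
contraction of `Ω` with `Z`. -/
lemma IsLcs.apply_eq_of_mem_center (h : IsLcs Ω ϑ) {Z : 𝔤} (hZ : Z ∈ center ℝ 𝔤)
    (hϑZ : ϑ Z = 1) (X Y : 𝔤) :
    Ω X Y = Ω Z ⁅X, Y⁆ + ϑ X * Ω Z Y - ϑ Y * Ω Z X := by
  have h1 := h.d_form X Y Z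
  have hYZ : ⁅Y, Z⁆ = 0 := hZ Y
  have hZX : ⁅Z, X⁆ = 0 := by rw [← lie_skew, hZ X, neg_zero]
  simp only [d₂, wedge₁₂, hYZ, hZX, hϑZ, map_zero, LinearMap.zero_apply] at h1
  have h2 := h.isAlt.neg_eq Z ⁅X, Y⁆
  have h3 := h.isAlt.neg_eq Z Y
  linear_combination -h1 + h2 + ϑ X * h3

/-- The contraction of `Ω` with a central element on which the Lee form is `1` defines a coadjoint
orbit in the quotient by the center whose stabilizer has small dimension. -/
lemma IsLcs.exists_finrank_center_add_finrank_ker_ad_le_two [FiniteDimensional ℝ 𝔤]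
    [HasCentralRadical ℝ 𝔤] (h : IsLcs Ω ϑ) {Z : 𝔤} (hZ : Z ∈ center ℝ 𝔤) (hϑZ : ϑ Z = 1) :
    ∃ d : 𝔤 ⧸ center ℝ 𝔤, finrank ℝ (center ℝ 𝔤) +
      finrank ℝ (LinearMap.ker (ad ℝ (𝔤 ⧸ center ℝ 𝔤) d)) ≤ 2 := by
  let π := quotientCenterMk ℝ 𝔤
  obtain ⟨σ, hσ⟩ := (π : 𝔤 →ₗ[ℝ] 𝔤 ⧸ center ℝ 𝔤).exists_rightInverse_of_surjective
    (LinearMap.range_eq_top.mpr (quotientCenterMk_surjective ℝ 𝔤))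
  replace hσ (x : 𝔤 ⧸ center ℝ 𝔤) : π (σ x) = x := LinearMap.congr_fun hσ x
  let ω : LinearMap.BilinForm ℝ (𝔤 ⧸ center ℝ 𝔤) :=
    LinearMap.mk₂ ℝ (fun x y ↦ Ω Z ⁅σ x, σ y⁆) (by simp) (by simp) (by simp) (by simp)
  have hlie {X X' : 𝔤} (hX : π X = π X') (Y : 𝔤) : ⁅X, Y⁆ = ⁅X', Y⁆ := by
    have : X - X' ∈ center ℝ 𝔤 := quotientCenterMk_eq_zero.mp (by
      rw [map_sub]; exact sub_eq_zero.mpr hX)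
    rw [← sub_eq_zero, ← sub_lie, ← lie_skew, this Y, neg_zero]
  have hω (X Y : 𝔤) : ω (π X) (π Y) = Ω Z ⁅X, Y⁆ := by
    change Ω Z ⁅σ (π X), σ (π Y)⁆ = _
    rw [hlie (hσ (π X)), ← lie_skew, hlie (hσ (π Y)), lie_skew]
  obtain ⟨d, hd⟩ := IsKilling.exists_eq_killingForm_lie_of_cocycle ω
    (fun x y ↦ by
      obtain ⟨X, rfl⟩ := quotientCenterMk_surjective ℝ 𝔤 x
      obtain ⟨Y, rfl⟩ := quotientCenterMk_surjective ℝ 𝔤 y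
      rw [hω, hω, ← lie_skew, map_neg])
    (fun x y z ↦ by
      obtain ⟨X, rfl⟩ := quotientCenterMk_surjective ℝ 𝔤 x
      obtain ⟨Y, rfl⟩ := quotientCenterMk_surjective ℝ 𝔤 y
      obtain ⟨W, rfl⟩ := quotientCenterMk_surjective ℝ 𝔤 z
      simp only [← LieHom.map_lie]
      rw [hω, hω, hω, ← map_add, ← map_add, ← lie_skew, ← lie_skew ⁅Y, W⁆, ← lie_skew ⁅W, X⁆,
        ← neg_add, ← neg_add, lie_jacobi, neg_zero, map_zero])
  refine ⟨d, ?_⟩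
  set C := LinearMap.ker (ad ℝ (𝔤 ⧸ center ℝ 𝔤) d)
  let s : (center ℝ 𝔤 × C) →ₗ[ℝ] 𝔤 :=
    (center ℝ 𝔤).toSubmodule.subtype.coprod (σ ∘ₗ C.subtype)
  have hs (p : center ℝ 𝔤 × C) : π (s p) = p.2 := by
    change π ((p.1 : 𝔤) + σ p.2) = p.2
    rw [map_add, hσ, quotientCenterMk_eq_zero.mpr p.1.2, zero_add]
  -- If `ϑ` and `Ω Z` both vanish at `s p`, then `Ω (s p) Y` reduces to `κ ⁅d, p.2⁆ (π Y) = 0`, so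
  -- `s p = 0`.
  have hinj : Function.Injective ((ϑ.prod (Ω Z)) ∘ₗ s) := by
    rw [← LinearMap.ker_eq_bot, LinearMap.ker_eq_bot']
    intro p hp
    obtain ⟨hp1, hp2⟩ : ϑ (s p) = 0 ∧ Ω Z (s p) = 0 := by simpa using hp
    have hsp : s p = 0 := by
      refine h.nondegenerate.1 _ fun Y ↦ ?_
      have hdp : ⁅d, (p.2 : 𝔤 ⧸ center ℝ 𝔤)⁆ = 0 := p.2.2
      rw [h.apply_eq_of_mem_center hZ hϑZ, hp1, hp2, ← hω, hs, hd, hdp]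
      simp
    have hp2' : p.2 = 0 := Subtype.ext (by rw [← hs, hsp, map_zero]; rfl)
    refine Prod.ext (Subtype.ext ?_) hp2'
    have : (p.1 : 𝔤) + σ p.2 = 0 := hsp
    simpa [hp2'] using this
  simpa using LinearMap.finrank_le_finrank_of_injective hinj

/-- A Lie algebra with a one-dimensional center on which the Lee form does not vanish splits off
its center. -/
lemma IsLcs.nonempty_lieEquiv_prod [FiniteDimensional ℝ 𝔤] (h : IsLcs Ω ϑ) {Z : 𝔤}
    (hZ : Z ∈ center ℝ 𝔤) (hϑZ : ϑ Z = 1) (hc : finrank ℝ (center ℝ 𝔤) = 1) {S : Type*}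
    [LieRing S] [LieAlgebra ℝ S] (e : (𝔤 ⧸ center ℝ 𝔤) ≃ₗ⁅ℝ⁆ S) :
    Nonempty (𝔤 ≃ₗ⁅ℝ⁆ (S × ℝ)) := by
  let f : 𝔤 →ₗ⁅ℝ⁆ S × ℝ := (e.toLieHom.comp (quotientCenterMk ℝ 𝔤)).prod h.leeHom
  have hf (X : 𝔤) : f X = (e (quotientCenterMk ℝ 𝔤 X), ϑ X) := rfl
  refine ⟨LieEquiv.ofBijective f ⟨?_, ?_⟩⟩
  · refine (injective_iff_map_eq_zero f).mpr fun X hX ↦ ?_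
    rw [hf, Prod.mk_eq_zero, map_eq_zero_iff e e.injective, quotientCenterMk_eq_zero] at hX
    obtain ⟨c, hc⟩ := (finrank_eq_one_iff_of_nonzero' (⟨Z, hZ⟩ : center ℝ 𝔤) (by
      intro h0
      have : Z = 0 := congrArg Subtype.val h0
      simp [this] at hϑZ)).mp hc ⟨X, hX.1⟩
    have hcX : c • Z = X := congrArg Subtype.val hc
    have := hX.2
    rw [← hcX, map_smul, hϑZ, smul_eq_mul, mul_one] at this
    rw [← hcX, this, zero_smul]
  · rintro ⟨s, t⟩
    obtain ⟨X, hX⟩ := quotientCenterMk_surjective ℝ 𝔤 (e.symm s)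
    refine ⟨X + (t - ϑ X) • Z, ?_⟩
    rw [hf, map_add, map_smul, quotientCenterMk_eq_zero.mpr hZ, hX]
    simp [hϑZ]

end LcsLie

theorem corollary3p2 {𝔤 : Type*} [LieRing 𝔤] [LieAlgebra ℝ 𝔤] [FiniteDimensional ℝ 𝔤]
    [LieAlgebra.HasCentralRadical ℝ 𝔤]
    (Ω : LinearMap.BilinForm ℝ 𝔤) (ϑ : Module.Dual ℝ 𝔤)
    (hlcs : LcsLie.IsLcs Ω ϑ) (hϑ : ϑ ≠ 0) :
    (Nonempty (𝔤 ≃ₗ⁅ℝ⁆ (LcsLie.su2 × ℝ)) ∨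
      Nonempty (𝔤 ≃ₗ⁅ℝ⁆ (LieAlgebra.SpecialLinear.sl (Fin 2) ℝ × ℝ))) ∧
    Module.finrank ℝ 𝔤 = 4 := by
  obtain ⟨Z, hZ, hϑZ⟩ := hlcs.exists_mem_center_lee_eq_one hϑ
  obtain ⟨d, hd⟩ := hlcs.exists_finrank_center_add_finrank_ker_ad_le_two hZ hϑZ
  have hsum : finrank ℝ (𝔤 ⧸ LieAlgebra.center ℝ 𝔤) + finrank ℝ (LieAlgebra.center ℝ 𝔤) =
      finrank ℝ 𝔤 := (LieAlgebra.center ℝ 𝔤).toSubmodule.finrank_quotient_add_finrank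
  have h4 := hlcs.four_le_finrank
  have hc : 1 ≤ finrank ℝ (LieAlgebra.center ℝ 𝔤) := by
    have : Nontrivial (LieAlgebra.center ℝ 𝔤) := ⟨⟨Z, hZ⟩, 0, fun h0 ↦ by
      have : Z = 0 := congrArg Subtype.val h0
      simp [this] at hϑZ⟩
    exact finrank_pos
  have hC : 1 ≤ finrank ℝ (LinearMap.ker (LieAlgebra.ad ℝ (𝔤 ⧸ LieAlgebra.center ℝ 𝔤) d)) := by
    -- If `d = 0`, its centralizer is the whole quotient and `hd` would give `dim 𝔤 ≤ 2`.
    by_cases hd0 : d = 0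
    · rw [hd0, map_zero, LinearMap.ker_zero, finrank_top] at hd ⊢
      omega
    · have : Nontrivial (LinearMap.ker (LieAlgebra.ad ℝ (𝔤 ⧸ LieAlgebra.center ℝ 𝔤) d)) :=
        ⟨⟨d, by simp⟩, 0, fun h0 ↦ hd0 (congrArg Subtype.val h0)⟩
      exact finrank_pos
  have hq : finrank ℝ (𝔤 ⧸ LieAlgebra.center ℝ 𝔤) ≤ 3 :=
    LieAlgebra.finrank_le_three_of_finrank_ker_ad_eq_one (x := d) (by omega)
  have hc1 : finrank ℝ (LieAlgebra.center ℝ 𝔤) = 1 := by omega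
  refine ⟨?_, by omega⟩
  rcases LcsLie.nonempty_lieEquiv_su2_or_sl2 (L := 𝔤 ⧸ LieAlgebra.center ℝ 𝔤) (by omega) with
    ⟨⟨e⟩⟩ | ⟨⟨e⟩⟩
  · exact .inl (hlcs.nonempty_lieEquiv_prod hZ hϑZ hc1 e)
  · exact .inr (hlcs.nonempty_lieEquiv_prod hZ hϑZ hc1 e)
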